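/- Let $k$ be a field. A quiver $Q$ is called toupie if it is finite and connected, has a unique source $0$ (a vertex at which no arrow ends) and a unique sink $\omega$ (a vertex at which no arrow starts), and every vertex other than $0$ and $\omega$ is the source of exactly one arrow and the target of exactly one arrow. A two-sided ideal $I$ of the path algebra $kQ$ is admissible if $kQ_{\ge m}\subseteq I\subseteq kQ_{\ge 2}$ for some $m\ge 2$, where $kQ_{\ge n}$ is the span of the paths of length at least $n$. An ideal $J$ of a finite-dimensional algebra $A$ is a heredity ideal if it is two-sided, $J^2=J$, $J\,\mathrm{rad}(A)\,J=0$, and $J$ is projective as a left $A$-module; $A$ is quasi-hereditary if there is a chain of two-sided ideals $0=J_0\subseteq J_1\subseteq\dots\subseteq J_n=A$ such that $J_{i+1}/J_i$ is a heredity ideal of $A/J_i$ for all $0\le i<n$. **Proposition.** Let $Q$ be a toupie quiver and $I\subseteq kQ$ an admissible ideal. Then the toupie algebra $A=kQ/I$ is (finite-dimensional and) quasi-hereditary. -/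

import Mathlib

universe u v w

/-! ### Path algebras of quivers with finitely many vertices -/

/-- A path of a quiver, of any length (length `0` included), bundled with its endpoints. -/
abbrev QuiverPath (V : Type u) [Quiver.{v} V] : Type (max u v) :=
  Σ a b : V, Quiver.Path a b

namespace QuiverPath

variable {V : Type u} [Quiver.{v} V]

/-- The source of a path. -/
abbrev source (p : QuiverPath V) : V := p.1

/-- The terminus of a path. -/
abbrev target (p : QuiverPath V) : V := p.2.1

/-- The length of a path. -/
abbrev length (p : QuiverPath V) : ℕ := p.2.2.length

/-- The trivial path at a vertex. -/
abbrev trivial (a : V) : QuiverPath V := ⟨a, a, Quiver.Path.nil⟩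

/-- The concatenation `pq` (first `p`, then `q`) of two composable paths. -/
def concat (p q : QuiverPath V) (h : p.target = q.source) : QuiverPath V :=
  ⟨p.1, q.2.1, p.2.2.comp (q.2.2.cast h.symm rfl)⟩

end QuiverPath

/-- The underlying vector space of the path algebra `KQ`: it has the set of all paths as a
basis. -/
def PathAlgebra (K : Type w) [Field K] (V : Type u) [Quiver.{v} V] : Type (max u v w) :=
  QuiverPath V →₀ K

namespace PathAlgebra

variable {K : Type w} [Field K] {V : Type u} [Quiver.{v} V]

noncomputable instance : AddCommGroup (PathAlgebra K V) :=
  inferInstanceAs (AddCommGroup (QuiverPath V →₀ K))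

noncomputable instance : Module K (PathAlgebra K V) :=
  inferInstanceAs (Module K (QuiverPath V →₀ K))

variable (K) in
/-- A path, as an element of the path algebra. -/
noncomputable def ofPath (p : QuiverPath V) : PathAlgebra K V :=
  Finsupp.single p (1 : K)

variable (K) in
open Classical in
/-- The product of two paths: their concatenation if they are composable, and `0` otherwise. -/
noncomputable def pathMul (p q : QuiverPath V) : PathAlgebra K V :=
  if h : p.target = q.source then ofPath K (p.concat q h) else 0

variable (K V) in
/-- The basis of the path algebra given by the paths. -/
noncomputable def pathBasis : Module.Basis (QuiverPath V) K (PathAlgebra K V) :=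
  Module.Basis.ofRepr (LinearEquiv.refl K (QuiverPath V →₀ K))

@[simp]
theorem pathBasis_apply (p : QuiverPath V) : pathBasis K V p = ofPath K p := rfl

variable (K V) in
/-- The multiplication of the path algebra, the bilinear extension of the product of paths. -/
noncomputable def mulLin : PathAlgebra K V →ₗ[K] PathAlgebra K V →ₗ[K] PathAlgebra K V :=
  (pathBasis K V).constr K fun p => (pathBasis K V).constr K fun q => pathMul K p q

noncomputable instance : Mul (PathAlgebra K V) := ⟨fun f g => mulLin K V f g⟩

theorem mul_def (f g : PathAlgebra K V) : f * g = mulLin K V f g := rfl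

@[simp]
theorem ofPath_mul_ofPath (p q : QuiverPath V) :
    ofPath K p * ofPath K q = pathMul K p q := by
  simp only [mul_def, mulLin, ← pathBasis_apply, Module.Basis.constr_basis]

theorem pathMul_of_eq {a b c : V} (p : Quiver.Path a b) (q : Quiver.Path b c) :
    pathMul K (⟨a, b, p⟩ : QuiverPath V) ⟨b, c, q⟩ = ofPath K ⟨a, c, p.comp q⟩ := by
  simp [pathMul, QuiverPath.concat]

theorem pathMul_of_ne (p q : QuiverPath V) (h : p.target ≠ q.source) :
    pathMul K p q = 0 := by
  simp [pathMul, h]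

theorem ofPath_mul_assoc (p q r : QuiverPath V) :
    (ofPath K p * ofPath K q) * ofPath K r = ofPath K p * (ofPath K q * ofPath K r) := by
  obtain ⟨a, b, p⟩ := p
  obtain ⟨b', c, q⟩ := q
  obtain ⟨c', d, r⟩ := r
  have zl (x : PathAlgebra K V) : (0 : PathAlgebra K V) * x = 0 := by simp [mul_def]
  have zr (x : PathAlgebra K V) : x * (0 : PathAlgebra K V) = 0 := by simp [mul_def]
  by_cases h : b = b' <;> by_cases h' : c = c'
  · subst h h'
    simp [pathMul_of_eq, Quiver.Path.comp_assoc]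
  · subst h
    simp [pathMul_of_eq, pathMul_of_ne, h', zr]
  · subst h'
    simp [pathMul_of_eq, pathMul_of_ne, h, zl]
  · simp [pathMul_of_ne, h, h', zl, zr]

variable [Fintype V]

/-- The unit of the path algebra is the sum of all trivial paths. -/
noncomputable instance : One (PathAlgebra K V) :=
  ⟨∑ a : V, ofPath K (QuiverPath.trivial a)⟩

theorem one_def : (1 : PathAlgebra K V) = ∑ a : V, ofPath K (QuiverPath.trivial a) := rfl

theorem one_mul_ofPath (p : QuiverPath V) : (1 : PathAlgebra K V) * ofPath K p = ofPath K p := by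
  obtain ⟨a, b, p⟩ := p
  rw [one_def, mul_def, map_sum, LinearMap.sum_apply, Finset.sum_eq_single a]
  · rw [← mul_def, ofPath_mul_ofPath, pathMul_of_eq, Quiver.Path.nil_comp]
  · intro c _ hc
    rw [← mul_def, ofPath_mul_ofPath, pathMul_of_ne _ _ hc]
  · simp

theorem ofPath_mul_one (p : QuiverPath V) : ofPath K p * (1 : PathAlgebra K V) = ofPath K p := by
  obtain ⟨a, b, p⟩ := p
  rw [one_def, mul_def, map_sum, Finset.sum_eq_single b]
  · rw [← mul_def, ofPath_mul_ofPath, pathMul_of_eq, Quiver.Path.comp_nil]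
  · intro c _ hc
    rw [← mul_def, ofPath_mul_ofPath, pathMul_of_ne _ _ (Ne.symm hc)]
  · simp

noncomputable instance : Ring (PathAlgebra K V) where
  __ := (inferInstance : AddCommGroup (PathAlgebra K V))
  mul := (· * ·)
  one := 1
  left_distrib f g h := map_add (mulLin K V f) g h
  right_distrib f g h := by simp only [mul_def, map_add, LinearMap.add_apply]
  zero_mul f := by simp [mul_def]
  mul_zero f := map_zero (mulLin K V f)
  mul_assoc f g h := by
    have key : (LinearMap.llcomp K _ _ _ ∘ₗ mulLin K V).compl₂ (mulLin K V) =
        (LinearMap.llcomp K _ _ _ (mulLin K V)) ∘ₗ mulLin K V := by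
      refine (pathBasis K V).ext fun p => (pathBasis K V).ext fun q => (pathBasis K V).ext fun r => ?_
      exact (ofPath_mul_assoc p q r).symm
    exact (LinearMap.congr_fun (LinearMap.congr_fun (LinearMap.congr_fun key f) g) h).symm
  one_mul f := by
    have key : mulLin K V 1 = LinearMap.id :=
      (pathBasis K V).ext fun p => one_mul_ofPath p
    exact LinearMap.congr_fun key f
  mul_one f := by
    have key : (mulLin K V).flip 1 = LinearMap.id :=
      (pathBasis K V).ext fun p => ofPath_mul_one p
    exact LinearMap.congr_fun key f

noncomputable instance : Algebra K (PathAlgebra K V) :=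
  Algebra.ofModule
    (fun c f g => by simp only [mul_def, map_smul, LinearMap.smul_apply])
    (fun c f g => by simp only [mul_def, map_smul])

variable (K V) in
/-- The subspace `KQ_{≥ n}` spanned by the paths of length at least `n`. For `n = 1` it is the
arrow ideal, and in general it is the `n`-th power of the arrow ideal. -/
noncomputable def lengthGE (n : ℕ) : Submodule K (PathAlgebra K V) :=
  Submodule.span K (ofPath K '' {p : QuiverPath V | n ≤ p.length})

/-- A two-sided ideal `I` of `KQ` is admissible if `KQ_{≥ m} ⊆ I ⊆ KQ_{≥ 2}` for some
`m ≥ 2`. -/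
def IsAdmissible (I : Ideal (PathAlgebra K V)) [I.IsTwoSided] : Prop :=
  (I : Set (PathAlgebra K V)) ⊆ (lengthGE K V 2 : Set (PathAlgebra K V)) ∧
    ∃ m : ℕ, 2 ≤ m ∧ (lengthGE K V m : Set (PathAlgebra K V)) ⊆ I

end PathAlgebra

/-! ### Toupie quivers -/

/-- A vertex is a source if no arrow ends in it. -/
def Quiver.IsSource {V : Type u} [Quiver.{v} V] (a : V) : Prop :=
  ∀ b : V, IsEmpty (b ⟶ a)

/-- A vertex is a sink if no arrow starts in it. -/
def Quiver.IsSink {V : Type u} [Quiver.{v} V] (a : V) : Prop :=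
  ∀ b : V, IsEmpty (a ⟶ b)

/-- A toupie quiver: a finite connected quiver with a unique source and a unique sink, any other
vertex of which is the source of exactly one arrow and the target of exactly one arrow. -/
structure IsToupieQuiver (V : Type u) [Quiver.{v} V] : Prop where
  finite_vertices : Finite V
  finite_arrows : ∀ a b : V, Finite (a ⟶ b)
  connected : Subsingleton (Quiver.WeaklyConnectedComponent V)
  unique_source : ∃! a : V, Quiver.IsSource a
  unique_sink : ∃! a : V, Quiver.IsSink a
  unique_arrow_out : ∀ a : V, ¬ Quiver.IsSource a → ¬ Quiver.IsSink a →
    Nonempty (Unique (Σ b : V, (a ⟶ b)))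
  unique_arrow_in : ∀ a : V, ¬ Quiver.IsSource a → ¬ Quiver.IsSink a →
    Nonempty (Unique (Σ b : V, (b ⟶ a)))

/-! ### Quasi-hereditary algebras -/

/-- A heredity ideal of a ring `A`: a two-sided ideal `J` with `J² = J` and `J rad(A) J = 0` that
is projective as a left `A`-module. (For finite-dimensional algebras, an ideal with the first two
properties is projective as a left module if and only if it is so as a right module.) -/
structure IsHeredityIdeal {A : Type u} [Ring A] (J : Ideal A) : Prop where
  twoSided : J.IsTwoSided
  idempotent : J * J = J
  mul_radical_mul : J * Ring.jacobson A * J = ⊥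
  projective : Module.Projective A J

/-- A finite-dimensional algebra `A` is quasi-hereditary if it has a chain
`0 = J₀ ⊆ J₁ ⊆ ⋯ ⊆ Jₙ = A` of two-sided ideals such that `Jᵢ₊₁ / Jᵢ` is a heredity ideal of
`A / Jᵢ` for each `i < n`. -/
def IsQuasiHereditary (K : Type w) [Field K] (A : Type u) [Ring A] [Algebra K A] : Prop :=
  FiniteDimensional K A ∧
    ∃ (n : ℕ) (J : Fin (n + 1) → Ideal A) (_ : ∀ i, (J i).IsTwoSided),
      J 0 = ⊥ ∧ J (Fin.last n) = ⊤ ∧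
      ∀ i : Fin n, J i.castSucc ≤ J i.succ ∧
        IsHeredityIdeal ((J i.succ).map (Ideal.Quotient.mk (J i.castSucc)))

/-! A toupie quiver has no oriented cycle, and every finite-dimensional quotient `A` of the path
algebra of an acyclic finite quiver is quasi-hereditary. Number the vertices so that arrows go to
smaller indices. Then `e i * A * e j = 0` for `i < j`, and `e i * A * e i` is spanned by `e i`, the
trivial path being the only closed one. The left ideals `A(e 0 + ⋯ + e (k-1))` are therefore
two-sided, and each step of this chain is generated, modulo the previous one, by an idempotent `e`
with `eB = eBe = Ke`. Such a `Be` is a heredity ideal: it is a direct summand of `B`, and `e`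
annihilates the radical. Admissibility gives finite dimension, since long paths vanish. -/

/-! ### Heredity chains from triangular families of idempotents -/

/-- If `e` is an idempotent of `B` with `eB = eBe = Ke`, then `Be` is a heredity ideal. -/
theorem isHeredityIdeal_span_idempotent (K : Type w) [Field K] {B : Type u} [Ring B] [Algebra K B]
    {e : B} (he : e * e = e) (hr : ∀ b, e * b = e * b * e)
    (hK : ∀ b, ∃ c : K, e * b * e = c • e) :
    IsHeredityIdeal (Ideal.span {e}) := by
  have hmem : ∀ x ∈ Ideal.span {e}, x * e = x := by
    intro x hx
    obtain ⟨b, rfl⟩ := Ideal.mem_span_singleton'.1 hx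
    rw [mul_assoc, he]
  have hself : e ∈ Ideal.span {e} := Ideal.mem_span_singleton_self e
  refine ⟨⟨fun {x} b hx => ?_⟩, ?_, ?_, ?_⟩
  · rw [← hmem x hx, mul_assoc, hr]
    exact Ideal.mul_mem_left _ _ (Ideal.mul_mem_left _ _ hself)
  · refine le_antisymm (Ideal.mul_le.2 fun x _ y hy => Ideal.mul_mem_left _ x hy) ?_
    rw [Ideal.span_singleton_le_iff_mem]
    simpa only [he] using Ideal.mul_mem_mul hself hself
  -- Otherwise `e * r` is a nonzero multiple of `e`, so `e` lies in the radical; then `1 - e` has a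
  -- left inverse, which forces `e = 0`.
  · have key : ∀ r ∈ Ring.jacobson B, e * r = 0 := by
      intro r hr'
      obtain ⟨c, hc⟩ := hK r
      rw [← hr r] at hc
      by_cases h0 : c = 0
      · rw [hc, h0, zero_smul]
      have hej : e ∈ Ring.jacobson B := by
        have h1 : (algebraMap K B c⁻¹ * e) * r = e := by
          rw [mul_assoc, hc, ← Algebra.smul_def, smul_smul, inv_mul_cancel₀ h0, one_smul]
        rw [← h1]
        exact Ideal.mul_mem_left _ _ hr'
      rw [← Ideal.jacobson_bot, Ideal.mem_jacobson_iff] at hej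
      obtain ⟨z, hz⟩ := hej (-1)
      have hz' : z * (1 - e) = 1 := by
        rw [Ideal.mem_bot] at hz
        rw [mul_sub, mul_one, ← sub_eq_zero, ← hz]
        noncomm_ring
      have : e = 0 := by
        calc e = z * (1 - e) * e := by rw [hz', one_mul]
          _ = 0 := by rw [mul_assoc, sub_mul, one_mul, he, sub_self, mul_zero]
      rw [this, zero_mul]
    rw [eq_bot_iff, Ideal.mul_le]
    intro x hx y hy
    have hx' : x = 0 := by
      have : Ideal.span {e} * Ring.jacobson B ≤ ⊥ := by
        rw [Ideal.mul_le]
        intro s hs t ht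
        rw [Ideal.mem_bot, ← hmem s hs, mul_assoc, key t ht, mul_zero]
      exact this hx
    rw [hx', zero_mul]
    exact zero_mem _
  -- Right multiplication by `e` retracts `B` onto `Be`.
  · refine Module.Projective.of_split (M := B) (Ideal.span {e}).subtype
      ((LinearMap.toSpanSingleton B B e).codRestrict (Ideal.span {e})
        fun b => Ideal.mul_mem_left _ _ hself) ?_
    ext x
    exact hmem x x.2

/-- A finite-dimensional algebra with a complete set of orthogonal idempotents `e i` such that
`e i * A * e j = 0` for `i < j` and `e i * A * e i = K (e i)` is quasi-hereditary. -/
theorem isQuasiHereditary_of_triangular (K : Type w) [Field K] {A : Type u} [Ring A] [Algebra K A]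
    [FiniteDimensional K A] {n : ℕ} {e : Fin n → A} (he : CompleteOrthogonalIdempotents e)
    (htri : ∀ i j, i < j → ∀ x, e i * x * e j = 0)
    (hdiag : ∀ i x, ∃ c : K, e i * x * e i = c • e i) :
    IsQuasiHereditary K A := by
  -- This is `A(e 0 + ⋯ + e (k-1))`, described by annihilation so that membership is checked one
  -- idempotent at a time.
  let J : Fin (n + 1) → Ideal A := fun k =>
    { carrier := {x | ∀ j : Fin n, k ≤ j.castSucc → x * e j = 0}
      add_mem' := fun {x y} hx hy j hj => by rw [add_mul, hx j hj, hy j hj, add_zero]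
      zero_mem' := fun j _ => zero_mul _
      smul_mem' := fun a x hx j hj => by rw [smul_eq_mul, mul_assoc, hx j hj, mul_zero] }
  have hJ : ∀ k x, x ∈ J k ↔ ∀ j : Fin n, k ≤ j.castSucc → x * e j = 0 := fun _ _ => Iff.rfl
  have hsum : ∀ x, x = ∑ i, x * e i := fun x => by rw [← Finset.mul_sum, he.complete, mul_one]
  have hid : ∀ i, e i * e i = e i := fun i => he.idem i
  have hort : ∀ i j, i ≠ j → e i * e j = 0 := fun i j h => he.ortho h
  have h2 : ∀ k, (J k).IsTwoSided := fun k => ⟨fun {x} a hx j hj => by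
    rw [hsum x, Finset.sum_mul, Finset.sum_mul]
    refine Finset.sum_eq_zero fun i _ => ?_
    rcases lt_or_ge i j with h | h
    · rw [mul_assoc, mul_assoc, ← mul_assoc (e i), htri i j h, mul_zero]
    · rw [hx i (hj.trans (Fin.castSucc_le_castSucc_iff.2 h)), zero_mul, zero_mul]⟩
  refine ⟨inferInstance, n, J, h2, ?_, ?_, fun k => ⟨?_, ?_⟩⟩
  · rw [eq_bot_iff]
    intro x hx
    rw [Ideal.mem_bot, hsum x]
    exact Finset.sum_eq_zero fun i _ => hx i (Fin.zero_le _)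
  · rw [Ideal.eq_top_iff_one]
    intro j hj
    exact absurd hj (not_le.2 (Fin.castSucc_lt_last j))
  · exact fun x hx j hj => hx j ((Fin.castSucc_lt_succ).le.trans hj)
  · have hek : e k ∈ J k.succ := fun j hj => hort k j
      (Fin.castSucc_lt_castSucc_iff.1 (Fin.castSucc_lt_succ.trans_le hj)).ne
    -- Modulo `J k` only the `e k` component survives. This gives both the generator of the layer
    -- and `eB = eBe`.
    have hmk : ∀ x ∈ J k.succ, Ideal.Quotient.mk (J k.castSucc) x =
        Ideal.Quotient.mk (J k.castSucc) (x * e k) := by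
      intro x hx
      rw [Ideal.Quotient.mk_eq_mk_iff_sub_mem]
      intro j hj
      rcases (Fin.castSucc_le_castSucc_iff.1 hj).eq_or_lt with rfl | h
      · rw [sub_mul, mul_assoc, hid, sub_self]
      · rw [sub_mul, mul_assoc, hort k j h.ne, mul_zero, sub_zero]
        exact hx j (Fin.succ_le_castSucc_iff.2 h)
    have hspan : (J k.succ).map (Ideal.Quotient.mk (J k.castSucc)) =
        Ideal.span {Ideal.Quotient.mk (J k.castSucc) (e k)} := by
      refine le_antisymm (Ideal.map_le_iff_le_comap.2 fun x hx => ?_) ?_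
      · rw [Ideal.mem_comap, hmk x hx, map_mul]
        exact Ideal.mul_mem_left _ _ (Ideal.mem_span_singleton_self _)
      · rw [Ideal.span_singleton_le_iff_mem]
        exact Ideal.mem_map_of_mem _ hek
    rw [hspan]
    refine isHeredityIdeal_span_idempotent K (by rw [← map_mul, hid]) ?_ ?_
    · intro b
      obtain ⟨a, rfl⟩ := Ideal.Quotient.mk_surjective b
      rw [← map_mul, ← map_mul]
      exact hmk _ ((h2 k.succ).mul_mem_of_left a hek)
    · intro b
      obtain ⟨a, rfl⟩ := Ideal.Quotient.mk_surjective b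
      obtain ⟨c, hc⟩ := hdiag k a
      refine ⟨c, ?_⟩
      rw [← map_mul, ← map_mul, hc]
      rfl

/-! ### Path algebras of acyclic quivers -/

namespace PathAlgebra

variable {K : Type w} [Field K] {V : Type u} [Quiver.{v} V]

theorem trivial_mul_ofPath_mul_trivial (a b : V) (p : QuiverPath V) :
    (∃ q : Quiver.Path a b, ofPath K (QuiverPath.trivial a) * ofPath K p *
      ofPath K (QuiverPath.trivial b) = ofPath K ⟨a, b, q⟩) ∨
    ofPath K (QuiverPath.trivial a) * ofPath K p * ofPath K (QuiverPath.trivial b) = 0 := by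
  have zl (x : PathAlgebra K V) : (0 : PathAlgebra K V) * x = 0 := by simp [mul_def]
  obtain ⟨c, d, p⟩ := p
  by_cases hc : a = c
  · subst hc
    rw [ofPath_mul_ofPath, pathMul_of_eq, Quiver.Path.nil_comp, ofPath_mul_ofPath]
    by_cases hd : d = b
    · subst hd
      exact Or.inl ⟨p, by rw [pathMul_of_eq, Quiver.Path.comp_nil]⟩
    · exact Or.inr (pathMul_of_ne _ _ hd)
  · refine Or.inr ?_
    rw [ofPath_mul_ofPath, pathMul_of_ne _ _ hc, zl]

variable [Fintype V]

/-- The corner of the path algebra at a pair of vertices is spanned by the paths between them. -/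
theorem trivial_mul_mul_trivial_mem_span (a b : V) (x : PathAlgebra K V) :
    ofPath K (QuiverPath.trivial a) * x * ofPath K (QuiverPath.trivial b) ∈
      Submodule.span K (Set.range fun q : Quiver.Path a b => ofPath K ⟨a, b, q⟩) := by
  have hx : x ∈ Submodule.span K (Set.range (pathBasis K V)) := (pathBasis K V).mem_span x
  induction hx using Submodule.span_induction with
  | mem x hx =>
    obtain ⟨p, rfl⟩ := hx
    rcases trivial_mul_ofPath_mul_trivial (K := K) a b p with ⟨q, hq⟩ | h
    · rw [pathBasis_apply, hq]
      exact Submodule.subset_span ⟨q, rfl⟩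
    · rw [pathBasis_apply, h]
      exact zero_mem _
  | zero =>
    rw [mul_zero, zero_mul]
    exact zero_mem _
  | add x y _ _ hx hy =>
    rw [mul_add, add_mul]
    exact add_mem hx hy
  | smul c x _ hx =>
    rw [mul_smul_comm, smul_mul_assoc]
    exact Submodule.smul_mem _ c hx

theorem completeOrthogonalIdempotents_trivial :
    CompleteOrthogonalIdempotents fun a : V => ofPath K (QuiverPath.trivial a) where
  idem a := by
    change _ * _ = _
    rw [ofPath_mul_ofPath, pathMul_of_eq, Quiver.Path.comp_nil]
  ortho a b h := by
    change _ * _ = _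
    rw [ofPath_mul_ofPath, pathMul_of_ne _ _ h]
  complete := (one_def).symm

theorem finite_paths_of_length [∀ a b : V, Finite (a ⟶ b)] (n : ℕ) (a b : V) :
    Finite {p : Quiver.Path a b // p.length = n} := by
  induction n generalizing b with
  | zero =>
    refine @Finite.of_subsingleton _ ⟨?_⟩
    rintro ⟨p, hp⟩ ⟨q, hq⟩
    obtain rfl := Quiver.Path.eq_of_length_zero p hp
    rw [Subtype.mk.injEq, Quiver.Path.eq_nil_of_length_zero p hp,
      Quiver.Path.eq_nil_of_length_zero q hq]
  | succ n ih =>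
    refine Finite.of_surjective
      (fun x : Σ c : V, {p : Quiver.Path a c // p.length = n} × (c ⟶ b) =>
        (⟨x.2.1.1.cons x.2.2, congrArg (· + 1) x.2.1.2⟩ :
          {p : Quiver.Path a b // p.length = n + 1})) ?_
    rintro ⟨_ | ⟨p, f⟩, hp⟩
    · cases hp
    · exact ⟨⟨_, ⟨p, Nat.succ_injective hp⟩, f⟩, rfl⟩

/-- The quotient of a path algebra of a finite quiver by an admissible ideal is
finite-dimensional. -/
theorem IsAdmissible.finiteDimensional [∀ a b : V, Finite (a ⟶ b)] {I : Ideal (PathAlgebra K V)}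
    [I.IsTwoSided] (hI : IsAdmissible I) : FiniteDimensional K (PathAlgebra K V ⧸ I) := by
  obtain ⟨-, m, -, hm⟩ := hI
  have hfin : {p : QuiverPath V | p.length < m}.Finite := by
    have := fun (n : ℕ) (a b : V) => finite_paths_of_length n a b
    refine (Set.finite_range
      (fun x : Σ (n : Fin m) (a b : V), {p : Quiver.Path a b // p.length = n} =>
        (⟨x.2.1, x.2.2.1, x.2.2.2.1⟩ : QuiverPath V))).subset ?_
    rintro ⟨a, b, p⟩ hp
    exact ⟨⟨⟨p.length, hp⟩, a, b, p, rfl⟩, rfl⟩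
  let π : PathAlgebra K V →ₗ[K] PathAlgebra K V ⧸ I := (Ideal.Quotient.mkₐ K I).toLinearMap
  have hπ : Function.Surjective π := Ideal.Quotient.mk_surjective
  refine ⟨Submodule.fg_def.2 ⟨_, hfin.image fun p => π (ofPath K p), ?_⟩⟩
  rw [eq_top_iff, ← LinearMap.range_eq_top.2 hπ, LinearMap.range_eq_map, ← (pathBasis K V).span_eq,
    Submodule.map_span_le]
  rintro _ ⟨p, rfl⟩
  rcases lt_or_ge p.length m with h | h
  · exact Submodule.subset_span ⟨p, h, rfl⟩
  · have : π (ofPath K p) = 0 := Ideal.Quotient.eq_zero_iff_mem.2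
      (hm (Submodule.subset_span ⟨p, h, rfl⟩))
    rw [pathBasis_apply, this]
    exact zero_mem _

/-- A finite-dimensional quotient of the path algebra of a quiver without oriented cycles is
quasi-hereditary. -/
theorem isQuasiHereditary_quotient_of_acyclic (hV : ∀ (a : V) (p : Quiver.Path a a), p.length = 0)
    (I : Ideal (PathAlgebra K V)) [I.IsTwoSided] [FiniteDimensional K (PathAlgebra K V ⧸ I)] :
    IsQuasiHereditary K (PathAlgebra K V ⧸ I) := by
  -- Paths descend in this order; acyclicity is exactly what antisymmetry needs. A linear extension
  -- then supplies the numbering.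
  let _ : PartialOrder V :=
    { le := fun a b => Nonempty (Quiver.Path b a)
      le_refl := fun a => ⟨Quiver.Path.nil⟩
      le_trans := fun a b c ⟨p⟩ ⟨q⟩ => ⟨q.comp p⟩
      le_antisymm := fun a b ⟨p⟩ ⟨q⟩ => by
        have h := hV b (p.comp q)
        rw [Quiver.Path.length_comp] at h
        exact (Quiver.Path.eq_of_length_zero p (by omega)).symm }
  let _ : Fintype (LinearExtension V) := inferInstanceAs (Fintype V)
  let s : Fin (Fintype.card (LinearExtension V)) ≃o LinearExtension V :=
    Fintype.orderIsoFinOfCardEq _ rfl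
  let t : Fin (Fintype.card (LinearExtension V)) ≃ V := s.toEquiv
  have ht : ∀ i j, Nonempty (Quiver.Path (t i) (t j)) → j ≤ i := fun i j h =>
    s.le_iff_le.1 ((toLinearExtension (α := V)).monotone (show t j ≤ t i from h))
  have he := (CompleteOrthogonalIdempotents.equiv t).2
    ((completeOrthogonalIdempotents_trivial (K := K) (V := V)).map (Ideal.Quotient.mk I))
  refine isQuasiHereditary_of_triangular K he ?_ ?_
  · intro i j hij x
    obtain ⟨x, rfl⟩ := Ideal.Quotient.mk_surjective x
    have : IsEmpty (Quiver.Path (t i) (t j)) :=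
      not_nonempty_iff.1 fun h => (ht i j h).not_gt hij
    have h := trivial_mul_mul_trivial_mem_span (t i) (t j) x
    rw [Set.range_eq_empty, Submodule.span_empty, Submodule.mem_bot] at h
    have h' := congrArg (Ideal.Quotient.mk I) h
    rwa [map_mul, map_mul, map_zero] at h'
  · intro i x
    obtain ⟨x, rfl⟩ := Ideal.Quotient.mk_surjective x
    have h := trivial_mul_mul_trivial_mem_span (t i) (t i) x
    have hr : (Set.range fun q : Quiver.Path (t i) (t i) => ofPath K ⟨t i, t i, q⟩) ⊆
        {ofPath K (QuiverPath.trivial (t i))} := by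
      rintro _ ⟨q, rfl⟩
      rw [Quiver.Path.eq_nil_of_length_zero q (hV _ q)]
      rfl
    obtain ⟨c, hc⟩ := Submodule.mem_span_singleton.1 (Submodule.span_mono hr h)
    refine ⟨c, ?_⟩
    have h' := congrArg (Ideal.Quotient.mkₐ K I) hc
    rw [map_smul, map_mul, map_mul] at h'
    exact h'.symm

end PathAlgebra

/-! ### Toupie quivers are acyclic -/

/-- A vertex on an oriented cycle is neither source nor sink, so its only incoming and outgoing
arrows belong to the cycle. Lying on a cycle thus spreads along arrows in both directions, and by
connectedness would reach the source. -/
theorem IsToupieQuiver.length_eq_zero {V : Type u} [Quiver.{v} V] (hQ : IsToupieQuiver V) (a : V)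
    (p : Quiver.Path a a) : p.length = 0 := by
  let S : V → Prop := fun x => ∃ p : Quiver.Path x x, p.length ≠ 0
  have hS : ∀ x, S x → ¬ Quiver.IsSource x ∧ ¬ Quiver.IsSink x := by
    rintro x ⟨p, hp⟩
    refine ⟨fun h => ?_, fun h => ?_⟩
    · cases p with
      | nil => exact hp rfl
      | cons q f => exact (h _).false f
    · obtain ⟨c, f, q, -, -⟩ := (Quiver.Path.length_ne_zero_iff_eq_comp p).1 hp
      exact (h _).false f
  have hout : ∀ x y (_ : x ⟶ y), S x → S y := by
    intro x y f hx
    obtain ⟨u⟩ := hQ.unique_arrow_out x (hS x hx).1 (hS x hx).2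
    obtain ⟨p, hp⟩ := hx
    obtain ⟨c, g, q, -, -⟩ := (Quiver.Path.length_ne_zero_iff_eq_comp p).1 hp
    obtain rfl : c = y := congrArg Sigma.fst ((u.uniq ⟨c, g⟩).trans (u.uniq ⟨y, f⟩).symm)
    -- The cycle is rotated: its first arrow, which ends where `f` does, is dropped and `f` is
    -- appended.
    exact ⟨q.cons f, Nat.succ_ne_zero _⟩
  have hin : ∀ x y (_ : x ⟶ y), S y → S x := by
    intro x y f hy
    obtain ⟨u⟩ := hQ.unique_arrow_in y (hS y hy).1 (hS y hy).2
    obtain ⟨p, hp⟩ := hy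
    cases p with
    | nil => exact absurd rfl hp
    | @cons c _ q g =>
      obtain rfl : c = x := congrArg Sigma.fst ((u.uniq ⟨c, g⟩).trans (u.uniq ⟨x, f⟩).symm)
      refine ⟨f.toPath.comp q, ?_⟩
      rw [Quiver.Path.length_comp, Quiver.Path.length_toPath]
      omega
  by_contra ha
  obtain ⟨o, ho, -⟩ := hQ.unique_source
  have hconn := hQ.connected.elim (Quiver.WeaklyConnectedComponent.mk a)
    (Quiver.WeaklyConnectedComponent.mk o)
  obtain ⟨z⟩ := Quiver.WeaklyConnectedComponent.eq a o |>.1 hconn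
  have hzig : ∀ (b : Quiver.Symmetrify V) (_ : Quiver.Path (V := Quiver.Symmetrify V) a b),
      S b := by
    intro b z
    induction z with
    | nil => exact ⟨p, ha⟩
    | cons _ f ih =>
      rcases f with f | f
      · exact hout _ _ f ih
      · exact hin _ _ f ih
  exact (hS o (hzig o z)).1 ho

theorem mainTheorem7 {K : Type w} [Field K] {V : Type u} [Quiver.{v} V] [Fintype V]
    (hQ : IsToupieQuiver V) (I : Ideal (PathAlgebra K V)) [I.IsTwoSided]
    (hI : PathAlgebra.IsAdmissible I) :
    IsQuasiHereditary K (PathAlgebra K V ⧸ I) := by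
  have := hQ.finite_arrows
  have := hI.finiteDimensional
  exact PathAlgebra.isQuasiHereditary_quotient_of_acyclic hQ.length_eq_zero I
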